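/- Let $N$ be a finite set of players. A weight system $(\omega,\Sigma)$ consists of weights $\omega\in\mathbb{R}_{>0}^N$ and an ordered partition $\Sigma=(N_1,\dots,N_m)$ of $N$ into nonempty layers; the priority of $i\in N_k$ is $p(i)=k$. For $\emptyset\neq T\subseteq N$ let $p(T)=\max_{i\in T}p(i)$, and for $i\in N$ let $\overline{\omega}_i^T=\omega_i$ if $i\in T$ and $p(i)=p(T)$, and $\overline{\omega}_i^T=0$ otherwise. A game $v\colon 2^N\to\mathbb{R}$ with $v(\emptyset)=0$ is $(\omega,\Sigma)$-convex if for all $S\subseteq T\subseteq N$ $$\sum_{i\in S}\overline{\omega}_i^T\bigl(v(T)-v(T\setminus\{i\})-v(S)+v(S\setminus\{i\})\bigr)\ge 0 .$$ For a graph $G=(N,E)$ the communication game is $v^G(S)=\sum_A v(A)$, where $A$ runs over the connected components of the subgraph of $G$ induced by $S$. The graph $G$ preserves $(\omega,\Sigma)$-convexity if $v^G$ is $(\omega,\Sigma)$-convex for every $(\omega,\Sigma)$-convex game $v$ on $N$. Let $G_k$ be the subgraph of $G$ induced by $N_k$. Two sets of nodes (or a set and a node) are linked if some edge of $G$ joins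 a node of one to a node of the other. A one-node graph counts as a star, and a single edge counts as a star centered at either endpoint. **Proposition.** Suppose that $G$ preserves $(\omega,\Sigma)$-convexity, and let $k\le k'<k''$ be priority levels. Let $C_1$ be a connected component of $G_k$ and $C_2$ a connected component of $G_{k'}$, with $C_1\ne C_2$, both linked to a connected component $C$ of $G_{k''}$. Then: 1. There is a node $i$ of $C$ such that $C_1$ and $C_2$ are both linked to $i$. 2. If $C_1$ and $C_2$ are not linked to each other, then (a) $C_2$ is a singleton, and there is a node $c$ of $C$ such that (b) $C$ is a star with center $c$, and $C_2$ is linked to $C$ only at $c$; (c) $C_1$ is linked to $C$ only at $c$; (d) $C_2$ is not linked to any connected component of $G_l$ for any $l<k'$; (e) every path in $G$ from a node of $C_1$ to a node of $C_2$ passes through $c$. 3. If $C_1$ and $C_2$ are linked to each other, then $k<k'$, and for every node $i$ as in 1 there are nodes $j_1\in C_1$ and $j_2\in C_2$ such that $i,j_1,j_2$ form a triangle in $G$ and such that every connected component $C_3$ of a graph $G_l$ with $l\le k'$, different from $C_1$ and $C_2$ and linked to $C$, is linked to $j_1$ and to $j_2$ and satisfies $l\notin\{k,k'\}$. -/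

import Mathlib

/-- A TU-game on the player set `N`: a characteristic function on coalitions vanishing at `∅`. -/
structure TUGame (N : Type*) where
  v : Finset N → ℝ
  v_empty : v ∅ = 0

/-- A weight system `(ω, Σ)` on `N`: positive weights `ω` and an ordered partition
`Σ = (N_1, ..., N_m)` of `N` into nonempty layers.  The ordered partition is recorded by its
priority map `p`, sending a player to the index in `{1, ..., m}` of the layer containing it;
the range condition says that every layer `N_1, ..., N_m` is nonempty. -/
structure WeightSystem (N : Type*) where
  ω : N → ℝ
  ω_pos : ∀ i, 0 < ω i
  m : ℕ
  p : N → ℕ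
  range_p : Set.range p = Set.Icc 1 m

namespace WeightSystem

variable {N : Type*}

/-- The layer `N_k` of players of priority `k`. -/
def layer [Fintype N] (W : WeightSystem N) (k : ℕ) : Finset N :=
  Finset.univ.filter fun i => W.p i = k

/-- The priority `p(S)` of a coalition: the largest `k` such that `N_k` meets `S`
(with value `0` for the empty coalition, where it is irrelevant). -/
def prio (W : WeightSystem N) (S : Finset N) : ℕ :=
  S.sup W.p

/-- The set of elements of `S` with the highest priority in `S`. -/
def top (W : WeightSystem N) (S : Finset N) : Finset N :=
  S.filter fun i => W.p i = W.prio S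

/-- The relative weight of `i` in `S`: it is `ω i` when `i` has highest priority in `S`,
and `0` for all other players. -/
def relWeight [DecidableEq N] (W : WeightSystem N) (S : Finset N) (i : N) : ℝ :=
  if i ∈ W.top S then W.ω i else 0

end WeightSystem

namespace TUGame

variable {N : Type*}

/-- `(ω, Σ)`-convexity (weighted average convexity) of a game. -/
def IsWeightedConvex [DecidableEq N] (W : WeightSystem N) (g : TUGame N) : Prop :=
  ∀ S T : Finset N, S ⊆ T →
    0 ≤ ∑ i ∈ S, W.relWeight T i * (g.v T - g.v (T \ {i}) - g.v S + g.v (S \ {i}))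

end TUGame

/-- `A` is (the vertex set of) a connected component of the subgraph of `G` induced by `S`. -/
def IsComponentIn {N : Type*} (G : SimpleGraph N) (S A : Finset N) : Prop :=
  ∃ K : (G.induce (S : Set N)).ConnectedComponent,
    (A : Set N) = Subtype.val '' K.supp

open Classical in
/-- The set `C_G(S)` of connected components of the subgraph of `G` induced by `S`. -/
noncomputable def inducedComponents {N : Type*} [Fintype N] (G : SimpleGraph N) (S : Finset N) :
    Finset (Finset N) :=
  Finset.univ.filter fun A => IsComponentIn G S A

/-- The empty coalition induces a graph without components. -/
theorem inducedComponents_empty {N : Type*} [Fintype N] (G : SimpleGraph N) :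
    inducedComponents G ∅ = ∅ := by
  classical
  unfold inducedComponents
  refine Finset.filter_eq_empty_iff.mpr ?_
  rintro A - ⟨K, -⟩
  induction K using SimpleGraph.ConnectedComponent.ind with
  | _ x => exact absurd x.2 (by simp)

/-- The communication game `v^G`: the worth of `S` is the sum of the worths of the connected
components of the subgraph induced by `S`. -/
noncomputable def TUGame.communication {N : Type*} [Fintype N] (g : TUGame N)
    (G : SimpleGraph N) : TUGame N where
  v S := ∑ A ∈ inducedComponents G S, g.v A
  v_empty := by rw [inducedComponents_empty, Finset.sum_empty]

/-- `G` preserves `(ω, Σ)`-convexity: the communication game of every `(ω, Σ)`-convex game on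
the player set is `(ω, Σ)`-convex. -/
def PreservesWeightedConvexity {N : Type*} [Fintype N] [DecidableEq N] (W : WeightSystem N)
    (G : SimpleGraph N) : Prop :=
  ∀ g : TUGame N, g.IsWeightedConvex W → (g.communication G).IsWeightedConvex W

/-- `A` is (the vertex set of) a connected component of `G_k`, the graph `G` restricted to the
players of priority `k`. -/
def IsLayerComponent {N : Type*} [Fintype N] (W : WeightSystem N) (G : SimpleGraph N) (k : ℕ)
    (A : Finset N) : Prop :=
  IsComponentIn G (W.layer k) A

/-- The node set `A` is linked to the node `i`. -/
def LinkedToNode {N : Type*} (G : SimpleGraph N) (A : Finset N) (i : N) : Prop :=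
  ∃ a ∈ A, G.Adj a i

/-- Two node sets are linked: some edge joins a node of `A` to a node of `B`. -/
def Linked {N : Type*} (G : SimpleGraph N) (A B : Finset N) : Prop :=
  ∃ b ∈ B, LinkedToNode G A b

/-- The subgraph of `G` induced by `A` is a star with center `c`.  A single node is a star, and
two adjacent nodes form a star centered at either of them. -/
def IsStarWithCenter {N : Type*} (G : SimpleGraph N) (A : Finset N) (c : N) : Prop :=
  ∃ hc : c ∈ A, G.induce (A : Set N) = SimpleGraph.starGraph ⟨c, hc⟩

/-- `A` is linked to `B` only at the node `c` of `B`. -/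
def LinkedOnlyAt {N : Type*} (G : SimpleGraph N) (A B : Finset N) (c : N) : Prop :=
  ∀ b ∈ B, LinkedToNode G A b ↔ b = c

/-! Preservation is tested on games with one veto player and two further relevant players. Players
below the highest priority of `T` have relative weight zero, so such a game can be weighted convex
without being supermodular. Its communication game only records to which of the two players the veto
player is joined. A contradiction arises when a highest-priority node loses marginal contribution
from `S` to `T` and no other node of its priority gains. This excludes four configurations:
`false_of_bypass`, `adj_of_adj_of_adj`, `false_of_pendant` and `false_of_branch`.

Inside `C`, the pendant obstruction makes the neighbours of an attached lower node dominate `C`. The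
exchange in `adj_of_adj_of_adj` then gives all attached lower nodes the same neighbours in `C`
(`adj_of_attached`), hence a common attachment. Across layers, the bypass obstruction shows that a
common neighbour of two nonadjacent lower nodes separates them (`not_joined_of_lower`).

If the two components are not linked, a second attachment would be a detour around the first, so
there is only one, and it is the center of a star. By the branch obstruction the upper of the two
components has no neighbours of at most its own priority, so it is a singleton. If they are linked,
their neighbours of a common attachment must be adjacent, since otherwise the link is a detour. The
same two arguments tie any third component to both of these nodes. -/

/-! ### Connectivity inside a coalition, in terms of walks. -/

section JoinedWithin

variable {N : Type*} {G : SimpleGraph N} {X Y A B : Finset N} {x y z : N}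

/-- The nodes `x` and `y` are joined by a walk of `G` that stays in `X`. -/
def JoinedWithin (G : SimpleGraph N) (X : Finset N) (x y : N) : Prop :=
  ∃ P : G.Walk x y, ∀ z ∈ P.support, z ∈ X

namespace JoinedWithin

theorem refl (h : x ∈ X) : JoinedWithin G X x x :=
  ⟨SimpleGraph.Walk.nil, by simpa using h⟩

theorem symm (h : JoinedWithin G X x y) : JoinedWithin G X y x := by
  obtain ⟨P, hP⟩ := h
  exact ⟨P.reverse, by simpa using hP⟩

theorem trans (h : JoinedWithin G X x y) (h' : JoinedWithin G X y z) : JoinedWithin G X x z := by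
  obtain ⟨P, hP⟩ := h
  obtain ⟨Q, hQ⟩ := h'
  refine ⟨P.append Q, fun w hw => ?_⟩
  rcases SimpleGraph.Walk.mem_support_append_iff P Q |>.1 hw with h | h
  exacts [hP w h, hQ w h]

theorem mono (h : JoinedWithin G X x y) (hXY : X ⊆ Y) : JoinedWithin G Y x y := by
  obtain ⟨P, hP⟩ := h
  exact ⟨P, fun z hz => hXY (hP z hz)⟩

theorem left_mem (h : JoinedWithin G X x y) : x ∈ X := by
  obtain ⟨P, hP⟩ := h
  exact hP x P.start_mem_support

theorem right_mem (h : JoinedWithin G X x y) : y ∈ X := h.symm.left_mem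

theorem of_adj (hx : x ∈ X) (hy : y ∈ X) (h : G.Adj x y) : JoinedWithin G X x y :=
  ⟨h.toWalk, by simp [hx, hy]⟩

theorem exists_adj (h : JoinedWithin G X x y) (hne : x ≠ y) : ∃ z ∈ X, G.Adj y z := by
  obtain ⟨P, hP⟩ := h.symm
  cases P with
  | nil => exact absurd rfl hne
  | cons hadj Q => exact ⟨_, hP _ (by simp), hadj⟩

/-- A property of `x` that is inherited along the edges inside `X` holds for all nodes joined
to `x`. -/
theorem induct {p : N → Prop} (h : JoinedWithin G X x y) (hx : p x)
    (step : ∀ a ∈ X, ∀ b ∈ X, G.Adj a b → p a → p b) : p y := by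
  obtain ⟨P, hP⟩ := h
  induction P with
  | nil => exact hx
  | cons hadj Q ih =>
    refine ih (step _ (hP _ (by simp)) _ (hP _ ?_) hadj hx) fun z hz => hP z (by simp [hz])
    simp

end JoinedWithin

theorem not_joined_of_isolated (hne : x ≠ y) (h : ∀ z ∈ X, ¬ G.Adj y z) : ¬ JoinedWithin G X x y :=
  fun hj => let ⟨z, hz, hadj⟩ := hj.exists_adj hne; h z hz hadj

theorem induce_reachable_iff_joined (hx : x ∈ X) (hy : y ∈ X) :
    (G.induce (X : Set N)).Reachable ⟨x, hx⟩ ⟨y, hy⟩ ↔ JoinedWithin G X x y := by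
  constructor
  · rintro ⟨P⟩
    refine ⟨P.map (SimpleGraph.Embedding.induce (X : Set N)).toHom, fun z hz => ?_⟩
    obtain ⟨w, -, rfl⟩ := List.mem_map.1 ((congrArg (z ∈ ·) (SimpleGraph.Walk.support_map
      (SimpleGraph.Embedding.induce (X : Set N)).toHom P)).mp hz)
    exact w.2
  · rintro ⟨P, hP⟩
    exact ⟨P.induce (X : Set N) hP⟩

/-- Trades components of a graph on a subtype for walks in `G`, so that different coalitions can be
compared. -/
theorem isComponentIn_iff :
    IsComponentIn G X A ↔ ∃ x ∈ X, ∀ y, y ∈ A ↔ JoinedWithin G X x y := by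
  constructor
  · rintro ⟨K, hK⟩
    induction K using SimpleGraph.ConnectedComponent.ind with
    | _ x =>
      refine ⟨x, x.2, fun y => ?_⟩
      rw [← Finset.mem_coe, hK]
      constructor
      · rintro ⟨w, hw, rfl⟩
        rw [SimpleGraph.ConnectedComponent.mem_supp_iff, SimpleGraph.ConnectedComponent.eq] at hw
        exact (induce_reachable_iff_joined x.2 w.2).1 hw.symm
      · intro hy
        refine ⟨⟨y, hy.right_mem⟩, ?_, rfl⟩
        rw [SimpleGraph.ConnectedComponent.mem_supp_iff, SimpleGraph.ConnectedComponent.eq]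
        exact ((induce_reachable_iff_joined x.2 hy.right_mem).2 hy).symm
  · rintro ⟨x, hx, hA⟩
    refine ⟨(G.induce (X : Set N)).connectedComponentMk ⟨x, hx⟩, ?_⟩
    ext y
    rw [Finset.mem_coe, hA]
    constructor
    · intro hy
      refine ⟨⟨y, hy.right_mem⟩, ?_, rfl⟩
      rw [SimpleGraph.ConnectedComponent.mem_supp_iff, SimpleGraph.ConnectedComponent.eq]
      exact ((induce_reachable_iff_joined hx hy.right_mem).2 hy).symm
    · rintro ⟨w, hw, rfl⟩
      rw [SimpleGraph.ConnectedComponent.mem_supp_iff, SimpleGraph.ConnectedComponent.eq] at hw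
      exact (induce_reachable_iff_joined hx w.2).1 hw.symm

namespace IsComponentIn

theorem mem_iff (hA : IsComponentIn G X A) (hx : x ∈ A) : y ∈ A ↔ JoinedWithin G X x y := by
  obtain ⟨a, -, h⟩ := isComponentIn_iff.1 hA
  rw [h] at hx ⊢
  exact ⟨hx.symm.trans, hx.trans⟩

theorem subset (hA : IsComponentIn G X A) : A ⊆ X :=
  fun _ hx => ((hA.mem_iff hx).1 hx).right_mem

theorem eq_of_mem (hA : IsComponentIn G X A) (hB : IsComponentIn G X B) (hxA : x ∈ A)
    (hxB : x ∈ B) : A = B := by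
  ext y
  rw [hA.mem_iff hxA, hB.mem_iff hxB]

/-- A component is connected. -/
theorem joined (hA : IsComponentIn G X A) (hx : x ∈ A) (hy : y ∈ A) : JoinedWithin G A x y := by
  obtain ⟨P, hP⟩ := (hA.mem_iff hx).1 hy
  classical
  refine ⟨P, fun z hz => (hA.mem_iff hx).2 ⟨P.takeUntil z hz, fun w hw => hP w ?_⟩⟩
  exact P.support_takeUntil_subset_support hz hw

end IsComponentIn

end JoinedWithin

/-! ### Test games with a veto player. -/

section VetoGame

variable {N : Type*} [DecidableEq N]

/-- The game in which nothing is earned without player `j`, who earns `α` with `a` alone, `β` with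
`b` alone, and `γ` with both. -/
def vetoGame (j a b : N) (α β γ : ℝ) : TUGame N where
  v S := if j ∈ S then
    (if a ∈ S then (if b ∈ S then γ else α) else if b ∈ S then β else 0) else 0
  v_empty := by simp

/-- With all three players in `T`, the only delicate coalitions `S` contain `j` and exactly one of
`a`, `b`. They give exactly `hwa` and `hwb`; every other case follows from monotonicity of the game.
-/
theorem vetoGame_isWeightedConvex (W : WeightSystem N) {j a b : N} {α β γ : ℝ}
    (hja : j ≠ a) (hjb : j ≠ b) (hab : a ≠ b)
    (hα : 0 ≤ α) (hβ : 0 ≤ β) (hαγ : α ≤ γ) (hβγ : β ≤ γ)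
    (hwa : ∀ T : Finset N, j ∈ T → a ∈ T →
      0 ≤ W.relWeight T j * (γ - α) + W.relWeight T a * (γ - α - β))
    (hwb : ∀ T : Finset N, j ∈ T → b ∈ T →
      0 ≤ W.relWeight T j * (γ - β) + W.relWeight T b * (γ - α - β)) :
    (vetoGame j a b α β γ).IsWeightedConvex W := by
  intro S T hST
  have hw : ∀ i, 0 ≤ W.relWeight T i := fun i => by
    unfold WeightSystem.relWeight
    split_ifs
    exacts [(W.ω_pos i).le, le_rfl]
  set g := vetoGame j a b α β γ with hg
  set f : N → ℝ := fun i =>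
    W.relWeight T i * (g.v T - g.v (T \ {i}) - g.v S + g.v (S \ {i})) with hf
  -- Removing any other player changes no worth.
  have hnull : ∀ i ∈ S, i ∉ S ∩ {j, a, b} → f i = 0 := by
    intro i hi hi'
    simp only [Finset.mem_inter, hi, true_and, Finset.mem_insert, Finset.mem_singleton,
      not_or] at hi'
    obtain ⟨h1, h2, h3⟩ := hi'
    simp [hf, hg, vetoGame, Ne.symm h1, Ne.symm h2, Ne.symm h3]
  have hsum : ∑ i ∈ S, f i = (if j ∈ S then f j else 0) +
      ((if a ∈ S then f a else 0) + if b ∈ S then f b else 0) := by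
    rw [← Finset.sum_subset Finset.inter_subset_left hnull, Finset.inter_comm,
      ← Finset.filter_mem_eq_inter, Finset.sum_filter,
      Finset.sum_insert (by simp [hja, hjb]), Finset.sum_insert (by simpa using hab),
      Finset.sum_singleton]
  change 0 ≤ ∑ i ∈ S, f i
  rw [hsum]
  have h1 := hwa T
  have h2 := hwb T
  have hj0 := hw j
  have ha0 := hw a
  have hb0 := hw b
  have hγ : 0 ≤ γ := hα.trans hαγ
  have e1 := mul_nonneg hj0 hα
  have e2 := mul_nonneg hj0 hβ
  have e3 := mul_nonneg hj0 hγ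
  have e4 := mul_nonneg ha0 hα
  have e5 := mul_nonneg ha0 (sub_nonneg.2 hβγ)
  have e6 := mul_nonneg hb0 hβ
  have e7 := mul_nonneg hb0 (sub_nonneg.2 hαγ)
  have e8 := mul_nonneg hj0 (sub_nonneg.2 hαγ)
  have e9 := mul_nonneg hj0 (sub_nonneg.2 hβγ)
  have hjT : j ∈ S → j ∈ T := @hST j
  have haT : a ∈ S → a ∈ T := @hST a
  have hbT : b ∈ S → b ∈ T := @hST b
  simp only [hf, hg, vetoGame, Finset.mem_sdiff, Finset.mem_singleton, hja, hjb, hab, hja.symm,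
    hjb.symm, hab.symm]
  clear hsum hnull hf hg f g hwa hwb hw
  generalize W.relWeight T j = wj at *
  generalize W.relWeight T a = wa at *
  generalize W.relWeight T b = wb at *
  by_cases j1 : j ∈ T <;> by_cases a1 : a ∈ T <;> by_cases b1 : b ∈ T <;>
  by_cases j2 : j ∈ S <;> by_cases a2 : a ∈ S <;> by_cases b2 : b ∈ S <;>
  first
  | exact absurd (hjT j2) j1
  | exact absurd (haT a2) a1
  | exact absurd (hbT b2) b1
  | (simp only [j1, a1, b1, j2, a2, b2, not_true_eq_false, not_false_eq_true, and_true,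
      and_false, if_true, if_false, forall_const] at h1 h2 ⊢
     linarith)

end VetoGame

/-! ### Relative weights and violations of weighted convexity. -/

namespace WeightSystem

variable {N : Type*} {W : WeightSystem N}

theorem mem_top_iff {T : Finset N} {i : N} :
    i ∈ W.top T ↔ i ∈ T ∧ ∀ t ∈ T, W.p t ≤ W.p i := by
  unfold top prio
  rw [Finset.mem_filter]
  refine and_congr_right fun hi => ⟨fun h t ht => h ▸ Finset.le_sup ht, fun h => ?_⟩
  exact le_antisymm (Finset.le_sup hi) (Finset.sup_le h)

variable [DecidableEq N]

theorem relWeight_of_top {T : Finset N} {i : N} (hi : i ∈ T) (h : ∀ t ∈ T, W.p t ≤ W.p i) :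
    W.relWeight T i = W.ω i := if_pos (mem_top_iff.2 ⟨hi, h⟩)

theorem relWeight_of_lt {T : Finset N} {i t : N} (ht : t ∈ T) (h : W.p i < W.p t) :
    W.relWeight T i = 0 := if_neg fun hi => (h.trans_le ((mem_top_iff.1 hi).2 t ht)).false

theorem relWeight_nonneg (T : Finset N) (i : N) : 0 ≤ W.relWeight T i := by
  unfold relWeight
  split_ifs
  exacts [(W.ω_pos i).le, le_rfl]

/-- A relation between weights that holds for all pairs of players with the priority of `j`
passes to relative weights. -/
theorem relWeight_combination_nonneg {T : Finset N} {j a : N} {x y : ℝ} (hj : j ∈ T) (ha : a ∈ T)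
    (hp : W.p a ≤ W.p j) (hx : 0 ≤ x) (h : W.p a = W.p j → 0 ≤ W.ω j * x + W.ω a * y) :
    0 ≤ W.relWeight T j * x + W.relWeight T a * y := by
  by_cases hat : ∀ t ∈ T, W.p t ≤ W.p a
  -- If `a` is on top of `T`, then so is `j`; otherwise the possibly negative term of `a` vanishes.
  · have he : W.p a = W.p j := le_antisymm hp (hat j hj)
    rw [relWeight_of_top ha hat, relWeight_of_top hj (he ▸ hat)]
    exact h he
  · push Not at hat
    obtain ⟨t, ht, hlt⟩ := hat
    rw [relWeight_of_lt ht hlt, zero_mul, add_zero]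
    exact mul_nonneg (relWeight_nonneg T j) hx

end WeightSystem

open WeightSystem

/-- In a weighted convex game, a player of highest priority in `T` whose marginal contribution
decreases must be compensated by another one. -/
theorem TUGame.IsWeightedConvex.false_of_decreasing {N : Type*} [DecidableEq N]
    {W : WeightSystem N} {g : TUGame N} (hg : g.IsWeightedConvex W)
    {S T : Finset N} (hST : S ⊆ T) {i : N} (hi : i ∈ S) (htop : ∀ t ∈ T, W.p t ≤ W.p i)
    (hlt : g.v T - g.v (T \ {i}) - g.v S + g.v (S \ {i}) < 0)
    (hle : ∀ s ∈ S, s ≠ i → W.p s = W.p i →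
      g.v T - g.v (T \ {s}) - g.v S + g.v (S \ {s}) ≤ 0) : False := by
  refine (hg S T hST).not_gt (Finset.sum_neg' (fun s hs => ?_) ⟨i, hi, ?_⟩)
  · by_cases hsi : s = i
    · subst hsi
      exact mul_nonpos_of_nonneg_of_nonpos (relWeight_nonneg T s) hlt.le
    · rcases lt_or_eq_of_le (htop s (hST hs)) with h | h
      · rw [relWeight_of_lt (hST hi) h, zero_mul]
      · exact mul_nonpos_of_nonneg_of_nonpos (relWeight_nonneg T s) (hle s hs hsi h)
  · rw [relWeight_of_top (hST hi) htop]
    exact mul_neg_of_pos_of_neg (W.ω_pos i) hlt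

/-! ### Communication games of veto games. -/

section Communication

variable {N : Type*} [Fintype N] [DecidableEq N] {G : SimpleGraph N} {W : WeightSystem N}
  {j a b : N} {α β γ : ℝ}

open Classical in
-- Only the component containing the veto player earns anything.
theorem vetoGame_communication (G : SimpleGraph N) (j a b : N) (α β γ : ℝ) (X : Finset N) :
    ((vetoGame j a b α β γ).communication G).v X =
      if JoinedWithin G X j a then (if JoinedWithin G X j b then γ else α)
      else if JoinedWithin G X j b then β else 0 := by
  change ∑ A ∈ inducedComponents G X, (vetoGame j a b α β γ).v A = _
  have hmem : ∀ {A}, A ∈ inducedComponents G X ↔ IsComponentIn G X A := by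
    simp [inducedComponents]
  have hzero : ∀ {A : Finset N}, j ∉ A → (vetoGame j a b α β γ).v A = 0 := fun h => if_neg h
  by_cases hj : j ∈ X
  · have hA : IsComponentIn G X (Finset.univ.filter (JoinedWithin G X j)) :=
      isComponentIn_iff.2 ⟨j, hj, by simp⟩
    have hjA : j ∈ Finset.univ.filter (JoinedWithin G X j) := by
      simpa using JoinedWithin.refl hj
    rw [Finset.sum_eq_single_of_mem _ (hmem.2 hA) fun B hB hne =>
      hzero fun hjB => hne ((hmem.1 hB).eq_of_mem hA hjB hjA)]
    simp [vetoGame, JoinedWithin.refl hj]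
  · rw [Finset.sum_eq_zero fun A hA => hzero fun hjA => hj ((hmem.1 hA).subset hjA),
      if_neg fun h => hj h.left_mem, if_neg fun h => hj h.left_mem]

theorem vetoGame_communication_of_joined_of_joined {X : Finset N} (ha : JoinedWithin G X j a)
    (hb : JoinedWithin G X j b) : ((vetoGame j a b α β γ).communication G).v X = γ := by
  rw [vetoGame_communication, if_pos ha, if_pos hb]

theorem vetoGame_communication_of_joined_left {X : Finset N} (ha : JoinedWithin G X j a)
    (hb : ¬ JoinedWithin G X j b) : ((vetoGame j a b α β γ).communication G).v X = α := by
  rw [vetoGame_communication, if_pos ha, if_neg hb]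

theorem vetoGame_communication_of_joined_right {X : Finset N} (ha : ¬ JoinedWithin G X j a)
    (hb : JoinedWithin G X j b) : ((vetoGame j a b α β γ).communication G).v X = β := by
  rw [vetoGame_communication, if_neg ha, if_pos hb]

theorem vetoGame_communication_of_not_joined {X : Finset N} (ha : ¬ JoinedWithin G X j a)
    (hb : ¬ JoinedWithin G X j b) : ((vetoGame j a b α β γ).communication G).v X = 0 := by
  rw [vetoGame_communication, if_neg ha, if_neg hb]

theorem vetoGame_communication_sdiff_veto (X : Finset N) :
    ((vetoGame j a b α β γ).communication G).v (X \ {j}) = 0 :=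
  vetoGame_communication_of_not_joined (fun h => by simpa using h.left_mem)
    (fun h => by simpa using h.left_mem)

/-! ### Forbidden configurations. -/

namespace PreservesWeightedConvexity

/-- If a node of highest priority in `T` separates `u` from `w` in some subset of `T`, then it
does so in `T`. -/
theorem false_of_bypass (hG : PreservesWeightedConvexity W G) {u w i : N} {S T : Finset N}
    (hne : u ≠ w) (hui : u ≠ i) (hwi : w ≠ i) (hST : S ⊆ T)
    (htop : ∀ t ∈ T, W.p t ≤ W.p i)
    (hS : JoinedWithin G S u w) (hSi : ¬ JoinedWithin G (S \ {i}) u w)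
    (hTi : JoinedWithin G (T \ {i}) u w) : False := by
  have hval : ∀ X, ((vetoGame u w i 1 0 1).communication G).v X =
      (by classical exact if JoinedWithin G X u w then 1 else 0) := by
    intro X
    rw [vetoGame_communication]
    split_ifs <;> rfl
  have hiS : i ∈ S := by
    by_contra h
    exact hSi (by rwa [Finset.sdiff_singleton_eq_erase, Finset.erase_eq_of_notMem h])
  -- This is the unanimity game of `{u, w}`; `i` only fills the third slot as a null player.
  refine (hG _ (vetoGame_isWeightedConvex W (j := u) (a := w) (b := i) (α := 1) (β := 0) (γ := 1)
    hne hui hwi (by norm_num) (by norm_num) (by norm_num) (by norm_num) (fun T _ _ => by simp)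
    fun T _ _ => by simpa using relWeight_nonneg T u)).false_of_decreasing hST hiS htop ?_ ?_
  · simp only [hval, hS, hSi, hTi, hS.mono hST, if_true, if_false]
    norm_num
  · intro s _ _ _
    simp only [hval, hS, hS.mono hST, if_true]
    by_cases h : JoinedWithin G (S \ {s}) u w
    · simp only [h, h.mono (Finset.sdiff_subset_sdiff hST subset_rfl), if_true]
      norm_num
    · simp only [h, if_false]
      split_ifs <;> norm_num

/-- Two nonadjacent nodes with a common neighbour `c` are not joined by another way through
nodes of at most the priority of `c`. -/
theorem not_joined_of_common_neighbor (hG : PreservesWeightedConvexity W G) {u w c : N}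
    {X : Finset N} (hne : u ≠ w) (huw : ¬ G.Adj u w) (huc : G.Adj u c) (hwc : G.Adj w c)
    (hcX : c ∉ X) (hX : ∀ x ∈ X, W.p x ≤ W.p c) : ¬ JoinedWithin G X u w := by
  intro h
  have hS : ({u, c, w} : Finset N) ⊆ insert c X := by
    intro x hx
    simp only [Finset.mem_insert, Finset.mem_singleton] at hx ⊢
    rcases hx with rfl | rfl | rfl
    exacts [.inr h.left_mem, .inl rfl, .inr h.right_mem]
  refine hG.false_of_bypass (i := c) hne huc.ne hwc.ne hS ?_ ?_ ?_ ?_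
  · intro t ht
    rcases Finset.mem_insert.1 ht with rfl | ht
    exacts [le_rfl, hX t ht]
  · exact (JoinedWithin.of_adj (by simp) (by simp) huc).trans
      (JoinedWithin.of_adj (by simp) (by simp) hwc.symm)
  · refine not_joined_of_isolated hne fun z hz hadj => ?_
    simp only [Finset.mem_sdiff, Finset.mem_insert, Finset.mem_singleton] at hz
    rcases hz with ⟨rfl | rfl | rfl, hzc⟩
    exacts [huw hadj.symm, hzc rfl, hadj.ne rfl]
  · refine h.mono fun x hx => ?_
    simp only [Finset.mem_sdiff, Finset.mem_insert, Finset.mem_singleton]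
    exact ⟨.inr hx, fun e => hcX (e ▸ hx)⟩

/-- Two lower nodes attached to adjacent nodes of the same priority share both attachments. -/
theorem adj_of_adj_of_adj (hG : PreservesWeightedConvexity W G) {a₁ a₂ c d : N} (hne : a₁ ≠ a₂)
    (hp₁ : W.p a₁ < W.p c) (hp₂ : W.p a₂ < W.p c) (hcd : W.p d = W.p c)
    (h₁ : G.Adj a₁ c) (h : G.Adj c d) (h₂ : G.Adj a₂ d) : G.Adj a₁ d := by
  by_contra hn
  have hd₁ : d ≠ a₁ := fun e => by subst e; omega
  have hd₂ : d ≠ a₂ := fun e => by subst e; omega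
  have hc₂ : c ≠ a₂ := fun e => by subst e; omega
  -- Either lower node suffices for `d`. This is not supermodular, but both have weight zero
  -- whenever `d` is present.
  have hconv := hG _ (vetoGame_isWeightedConvex W (j := d) (a := a₁) (b := a₂) (α := 1) (β := 1)
    (γ := 1) hd₁ hd₂ hne (by norm_num) (by norm_num) (by norm_num) (by norm_num)
    (fun T hj ha => relWeight_combination_nonneg hj ha (by omega) (by norm_num)
      fun e => absurd e (by omega))
    fun T hj hb => relWeight_combination_nonneg hj hb (by omega) (by norm_num)
      fun e => absurd e (by omega))
  have hS₁ : JoinedWithin G {a₁, c, d} d a₁ :=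
    (JoinedWithin.of_adj (by simp) (by simp) h.symm).trans
      (JoinedWithin.of_adj (by simp) (by simp) h₁.symm)
  have hS₂ : ¬ JoinedWithin G {a₁, c, d} d a₂ := fun hj => by
    simpa [hd₂.symm, hc₂.symm, hne.symm] using hj.right_mem
  have hT₂ : ∀ {X : Finset N}, d ∈ X → a₂ ∈ X → JoinedWithin G X d a₂ :=
    fun hd ha => JoinedWithin.of_adj hd ha h₂.symm
  refine hconv.false_of_decreasing (S := {a₁, c, d}) (T := {a₁, a₂, c, d}) (i := c)
    ?_ (by simp) ?_ ?_ ?_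
  · intro x
    simp only [Finset.mem_insert, Finset.mem_singleton]
    tauto
  · simp only [Finset.mem_insert, Finset.mem_singleton, forall_eq_or_imp, forall_eq]
    omega
  -- In `S`, `d` needs `c` to reach `a₁`; in `T` it still earns `1` through `a₂` when `c` leaves.
  · have hTc : JoinedWithin G (({a₁, a₂, c, d} : Finset N) \ {c}) d a₂ :=
      hT₂ (by simp [h.ne.symm]) (by simp [hc₂.symm])
    rw [vetoGame_communication_of_joined_of_joined (hS₁.mono (by
        intro x
        simp only [Finset.mem_insert, Finset.mem_singleton]
        tauto)) (hT₂ (by simp) (by simp)),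
      vetoGame_communication_of_joined_left hS₁ hS₂,
      vetoGame_communication_of_not_joined (X := {a₁, c, d} \ {c})]
    · by_cases h' : JoinedWithin G (({a₁, a₂, c, d} : Finset N) \ {c}) d a₁
      · rw [vetoGame_communication_of_joined_of_joined h' hTc]
        norm_num
      · rw [vetoGame_communication_of_joined_right h' hTc]
        norm_num
    · refine not_joined_of_isolated hd₁ fun z hz hadj => ?_
      simp only [Finset.mem_sdiff, Finset.mem_insert, Finset.mem_singleton] at hz
      rcases hz with ⟨rfl | rfl | rfl, hzc⟩
      exacts [hadj.ne rfl, hzc rfl, hn hadj]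
    · exact fun hj => hS₂ (hj.mono Finset.sdiff_subset)
  · intro s hs hsc hps
    simp only [Finset.mem_insert, Finset.mem_singleton] at hs
    rcases hs with rfl | rfl | rfl
    · omega
    · exact absurd rfl hsc
    · rw [vetoGame_communication_sdiff_veto, vetoGame_communication_sdiff_veto,
        vetoGame_communication_of_joined_of_joined (hS₁.mono (by
          intro x
          simp only [Finset.mem_insert, Finset.mem_singleton]
          tauto)) (hT₂ (by simp) (by simp)),
        vetoGame_communication_of_joined_left hS₁ hS₂]
      norm_num

/-- A lower node attached to `c` cannot miss both ends of an edge one of whose ends is adjacent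
to `c` inside the layer of `c`. -/
theorem false_of_pendant (hG : PreservesWeightedConvexity W G) {a c e d : N}
    (hpa : W.p a < W.p c) (hpe : W.p e = W.p c) (hpd : W.p d = W.p c) (hdc : d ≠ c)
    (hac : G.Adj a c) (hce : G.Adj c e) (hed : G.Adj e d)
    (hae : ¬ G.Adj a e) (had : ¬ G.Adj a d) : False := by
  have hea : e ≠ a := fun h => by subst h; omega
  have had' : a ≠ d := fun h => by subst h; omega
  have hωe := W.ω_pos e
  have hωd := W.ω_pos d
  have hsum : 0 < W.ω d + W.ω e := add_pos hωd hωe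
  -- The largest worth of `{e, d}` for which the game stays convex: `ω e * (1 - y) = ω d * y`. The
  -- violation at `c` is then `-y`.
  set y : ℝ := W.ω e / (W.ω d + W.ω e) with hy
  have hy0 : 0 < y := div_pos hωe hsum
  have hy1 : y ≤ 1 := by
    rw [hy, div_le_one hsum]
    linarith
  have hyeq : y * (W.ω d + W.ω e) = W.ω e := div_mul_cancel₀ _ hsum.ne'
  have hconv := hG _ (vetoGame_isWeightedConvex W (j := e) (a := a) (b := d) (α := 1) (β := y)
    (γ := 1) hea hed.ne had' (by norm_num) hy0.le (by norm_num) hy1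
    (fun T hj ha => relWeight_combination_nonneg hj ha (by omega) (by norm_num)
      fun e => absurd e (by omega))
    fun T hj hb => relWeight_combination_nonneg hj hb (by omega) (by linarith)
      fun _ => by linarith)
  have hS₁ : JoinedWithin G {a, c, e} e a :=
    (JoinedWithin.of_adj (by simp) (by simp) hce.symm).trans
      (JoinedWithin.of_adj (by simp) (by simp) hac.symm)
  have hS₂ : ¬ JoinedWithin G {a, c, e} e d := fun hj => by
    simpa [hed.ne.symm, hdc, had'.symm] using hj.right_mem
  have hsub : ({a, c, e} : Finset N) ⊆ {a, c, d, e} := by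
    intro x
    simp only [Finset.mem_insert, Finset.mem_singleton]
    tauto
  refine hconv.false_of_decreasing (i := c) hsub (by simp) ?_ ?_ ?_
  · simp only [Finset.mem_insert, Finset.mem_singleton, forall_eq_or_imp, forall_eq]
    omega
  · have hisol : ∀ {X : Finset N}, X ⊆ {a, c, d, e} → c ∉ X → ¬ JoinedWithin G X e a := by
      intro X hX hcX
      refine not_joined_of_isolated hea fun z hz hadj => ?_
      have hz' := hX hz
      simp only [Finset.mem_insert, Finset.mem_singleton] at hz'
      rcases hz' with rfl | rfl | rfl | rfl
      exacts [hadj.ne rfl, hcX hz, had hadj, hae hadj]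
    rw [vetoGame_communication_of_joined_of_joined (hS₁.mono hsub)
        (JoinedWithin.of_adj (by simp) (by simp) hed),
      vetoGame_communication_of_joined_left hS₁ hS₂,
      vetoGame_communication_of_not_joined (X := {a, c, e} \ {c})
        (hisol (Finset.sdiff_subset.trans hsub) (by simp))
        (fun hj => hS₂ (hj.mono Finset.sdiff_subset)),
      vetoGame_communication_of_joined_right (X := {a, c, d, e} \ {c})
        (hisol Finset.sdiff_subset (by simp))
        (JoinedWithin.of_adj (by simp [hce.ne.symm]) (by simp [hdc]) hed)]
    linarith
  · intro s hs hsc hps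
    simp only [Finset.mem_insert, Finset.mem_singleton] at hs
    rcases hs with rfl | rfl | rfl
    · omega
    · exact absurd rfl hsc
    · rw [vetoGame_communication_sdiff_veto, vetoGame_communication_sdiff_veto,
        vetoGame_communication_of_joined_of_joined (hS₁.mono hsub)
          (JoinedWithin.of_adj (by simp) (by simp) hed),
        vetoGame_communication_of_joined_left hS₁ hS₂]
      norm_num

/-- If `c` joins two nonadjacent lower nodes `a` and `u`, then `u` has no other neighbour of at
most its own priority that is not adjacent to `a`. -/
theorem false_of_branch (hG : PreservesWeightedConvexity W G) {a u b c : N}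
    (hpa : W.p a ≤ W.p u) (hpb : W.p b ≤ W.p u) (hpu : W.p u < W.p c) (hne : a ≠ u) (hab : a ≠ b)
    (hac : G.Adj a c) (huc : G.Adj u c) (hub : G.Adj u b)
    (hau : ¬ G.Adj a u) (hadj_ab : ¬ G.Adj a b) : False := by
  have hcb : c ≠ b := fun h => by subst h; omega
  have hωa := W.ω_pos a
  have hωu := W.ω_pos u
  have hωb := W.ω_pos b
  have hsum : 0 < W.ω a + W.ω u + W.ω b := by positivity
  -- Having all three weights in the denominator makes one `y` serve both convexity conditions, even
  -- if `a`, `u`, `b` share a priority. The violation at `c` is `-y`.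
  set y : ℝ := W.ω u / (W.ω a + W.ω u + W.ω b) with hy
  have hy0 : 0 < y := div_pos hωu hsum
  have hy1 : y ≤ 1 := by
    rw [hy, div_le_one hsum]
    linarith
  have hyeq : y * (W.ω a + W.ω u + W.ω b) = W.ω u := div_mul_cancel₀ _ hsum.ne'
  have hya := mul_pos hy0 hωa
  have hyb := mul_pos hy0 hωb
  have hconv := hG _ (vetoGame_isWeightedConvex W (j := u) (a := a) (b := b) (α := 1) (β := 1)
    (γ := 2 - y) hne.symm hub.ne hab (by norm_num) (by norm_num) (by linarith) (by linarith)
    (fun T hj ha => relWeight_combination_nonneg hj ha (by omega) (by linarith)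
      fun _ => by linarith)
    fun T hj hb => relWeight_combination_nonneg hj hb (by omega) (by linarith)
      fun _ => by linarith)
  have hS₁ : JoinedWithin G {a, u, c} u a :=
    (JoinedWithin.of_adj (by simp) (by simp) huc).trans
      (JoinedWithin.of_adj (by simp) (by simp) hac.symm)
  have hS₂ : ¬ JoinedWithin G {a, u, c} u b := fun hj => by
    simpa [hub.ne.symm, hcb.symm, hab.symm] using hj.right_mem
  have hsub : ({a, u, c} : Finset N) ⊆ {a, u, b, c} := by
    intro x
    simp only [Finset.mem_insert, Finset.mem_singleton]
    tauto
  refine hconv.false_of_decreasing (i := c) hsub (by simp) ?_ ?_ ?_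
  · simp only [Finset.mem_insert, Finset.mem_singleton, forall_eq_or_imp, forall_eq]
    omega
  · have hisol : ∀ {X : Finset N}, X ⊆ {a, u, b, c} → c ∉ X → ¬ JoinedWithin G X u a := by
      intro X hX hcX
      refine not_joined_of_isolated hne.symm fun z hz hadj => ?_
      have hz' := hX hz
      simp only [Finset.mem_insert, Finset.mem_singleton] at hz'
      rcases hz' with rfl | rfl | rfl | rfl
      exacts [hadj.ne rfl, hau hadj, hadj_ab hadj, hcX hz]
    rw [vetoGame_communication_of_joined_of_joined (hS₁.mono hsub)
        (JoinedWithin.of_adj (by simp) (by simp) hub),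
      vetoGame_communication_of_joined_left hS₁ hS₂,
      vetoGame_communication_of_not_joined (X := {a, u, c} \ {c})
        (hisol (Finset.sdiff_subset.trans hsub) (by simp))
        (fun hj => hS₂ (hj.mono Finset.sdiff_subset)),
      vetoGame_communication_of_joined_right (X := {a, u, b, c} \ {c})
        (hisol Finset.sdiff_subset (by simp))
        (JoinedWithin.of_adj (by simp [huc.ne]) (by simp [hcb.symm]) hub)]
    linarith
  · intro s hs hsc hps
    simp only [Finset.mem_insert, Finset.mem_singleton] at hs
    rcases hs with rfl | rfl | rfl
    · omega
    · omega
    · exact absurd rfl hsc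

end PreservesWeightedConvexity

end Communication

/-! ### Attachments of lower nodes to a layer component. -/

section Layers

open PreservesWeightedConvexity

variable {N : Type*} [Fintype N] {G : SimpleGraph N} {W : WeightSystem N} {k l : ℕ}
  {A B C : Finset N} {x y : N}

namespace IsLayerComponent

theorem prio_eq (hA : IsLayerComponent W G k A) (hx : x ∈ A) : W.p x = k := by
  simpa [WeightSystem.layer] using IsComponentIn.subset hA hx

theorem mem_of_adj (hA : IsLayerComponent W G k A) (hx : x ∈ A) (hy : W.p y = k)
    (h : G.Adj x y) : y ∈ A :=
  (IsComponentIn.mem_iff hA hx).2 <| JoinedWithin.of_adj (IsComponentIn.subset hA hx)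
    (by simpa [WeightSystem.layer] using hy) h

theorem eq_of_mem (hA : IsLayerComponent W G k A) (hB : IsLayerComponent W G l B)
    (hxA : x ∈ A) (hxB : x ∈ B) : A = B := by
  obtain rfl : k = l := (hA.prio_eq hxA).symm.trans (hB.prio_eq hxB)
  exact IsComponentIn.eq_of_mem hA hB hxA hxB

theorem ne_of_mem (hA : IsLayerComponent W G k A) (hB : IsLayerComponent W G l B) (hne : A ≠ B)
    (hx : x ∈ A) (hy : y ∈ B) : x ≠ y := by
  rintro rfl
  exact hne (hA.eq_of_mem hB hx hy)

/-- Distinct components that are linked belong to distinct layers. -/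
theorem layer_ne_of_linked (hA : IsLayerComponent W G k A) (hB : IsLayerComponent W G l B)
    (hne : A ≠ B) (h : Linked G A B) : k ≠ l := by
  rintro rfl
  obtain ⟨b, hb, a, ha, hadj⟩ := h
  exact hne (hA.eq_of_mem hB (hA.mem_of_adj ha (hB.prio_eq hb) hadj) hb)

variable [DecidableEq N]

/-- If a lower node is attached to a component, then each node of the component is adjacent to it
or to one of its neighbours in the component. -/
theorem adj_or_exists_adj (hG : PreservesWeightedConvexity W G) (hC : IsLayerComponent W G l C)
    {a c x : N} (ha : W.p a < l) (hc : c ∈ C) (hac : G.Adj a c) (hx : x ∈ C) :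
    G.Adj a x ∨ ∃ z ∈ C, G.Adj a z ∧ G.Adj z x := by
  refine (IsComponentIn.joined hC hc hx).induct (p := fun x => G.Adj a x ∨
    ∃ z ∈ C, G.Adj a z ∧ G.Adj z x) (Or.inl hac) fun u hu v hv huv hpu => ?_
  by_cases hau : G.Adj a u
  · exact Or.inr ⟨u, hu, hau, huv⟩
  · obtain ⟨z, hz, haz, hzu⟩ := hpu.resolve_left hau
    by_cases hav : G.Adj a v
    · exact Or.inl hav
    · have hpz := hC.prio_eq hz
      have hpu := hC.prio_eq hu
      have hpv := hC.prio_eq hv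
      -- Otherwise `a`, `z`, `u`, `v` would form a pendant configuration.
      refine (hG.false_of_pendant (by omega) (by omega) (by omega) ?_ haz hzu huv hau hav).elim
      rintro rfl
      exact hav haz

/-- All lower nodes attached to a component have the same neighbours in it. -/
theorem adj_of_attached (hG : PreservesWeightedConvexity W G) (hC : IsLayerComponent W G l C)
    {a₁ a₂ c d : N} (h₁ : W.p a₁ < l) (h₂ : W.p a₂ < l) (hc : c ∈ C) (hd : d ∈ C)
    (hac : G.Adj a₁ c) (had : G.Adj a₂ d) : G.Adj a₁ d := by
  by_cases hne : a₁ = a₂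
  · rwa [hne]
  · rcases adj_or_exists_adj hG hC h₁ hc hac hd with h | ⟨z, hz, haz, hzd⟩
    · exact h
    · have hpz := hC.prio_eq hz
      have hpd := hC.prio_eq hd
      exact hG.adj_of_adj_of_adj hne (by omega) (by omega) (by omega) haz hzd had

end IsLayerComponent

/-! ### Two lower components attached to the same higher one. -/

open IsLayerComponent

variable [DecidableEq N] {m : ℕ} {A₁ A₂ : Finset N}

/-- In two linked lower components, all neighbours of a common attachment are adjacent. -/
theorem adj_of_linked (hG : PreservesWeightedConvexity W G)
    (hA₁ : IsLayerComponent W G k A₁) (hA₂ : IsLayerComponent W G l A₂) (hne : A₁ ≠ A₂)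
    (h : Linked G A₁ A₂) {a₁ a₂ c : N} (hk : k < W.p c) (hl : l < W.p c)
    (h₁ : a₁ ∈ A₁) (h₂ : a₂ ∈ A₂) (hc₁ : G.Adj a₁ c) (hc₂ : G.Adj a₂ c) : G.Adj a₁ a₂ := by
  by_contra hn
  obtain ⟨b₂, hb₂, b₁, hb₁, hadj⟩ := h
  have hp : ∀ x ∈ A₁ ∪ A₂, W.p x < W.p c := fun x hx => by
    rcases Finset.mem_union.1 hx with hx | hx
    · rwa [hA₁.prio_eq hx]
    · rwa [hA₂.prio_eq hx]
  refine hG.not_joined_of_common_neighbor (X := A₁ ∪ A₂) (hA₁.ne_of_mem hA₂ hne h₁ h₂) hn hc₁ hc₂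
    (fun hc => (hp c hc).false) (fun x hx => (hp x hx).le) ?_
  exact (((IsComponentIn.joined hA₁ h₁ hb₁).mono Finset.subset_union_left).trans
    (.of_adj (Finset.mem_union_left _ hb₁) (Finset.mem_union_right _ hb₂) hadj)).trans
    ((IsComponentIn.joined hA₂ hb₂ h₂).mono Finset.subset_union_right)

/-- A common neighbour of two nonadjacent lower nodes separates them in the whole graph. -/
theorem PreservesWeightedConvexity.not_joined_of_lower (hG : PreservesWeightedConvexity W G)
    {u w c : N} {X : Finset N} (hne : u ≠ w) (huw : ¬ G.Adj u w) (huc : G.Adj u c)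
    (hwc : G.Adj w c) (hpu : W.p u < W.p c) (hpw : W.p w < W.p c) (hcX : c ∉ X) :
    ¬ JoinedWithin G X u w := by
  intro h
  -- In a minimal joining set every node separates `u` from `w`. If its highest node `i` lies above
  -- `c`, adding `c` creates the bypass `u`, `c`, `w` around `i`.
  obtain ⟨S, hSX, hS⟩ :=
    exists_minimal_le_of_wellFoundedLT (fun Y : Finset N => JoinedWithin G Y u w) X h
  by_cases hp : ∀ x ∈ S, W.p x ≤ W.p c
  · exact hG.not_joined_of_common_neighbor hne huw huc hwc (fun hc => hcX (hSX hc)) hp hS.prop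
  · push Not at hp
    obtain ⟨x, hx, hcx⟩ := hp
    obtain ⟨i, hi, hmax⟩ := S.exists_max_image W.p ⟨x, hx⟩
    have hci : W.p c < W.p i := hcx.trans_le (hmax x hx)
    have hui : u ≠ i := by rintro rfl; omega
    have hwi : w ≠ i := by rintro rfl; omega
    have hc_ne : c ≠ i := by rintro rfl; omega
    refine hG.false_of_bypass (S := S) (T := insert c S) hne hui hwi (Finset.subset_insert _ _)
      ?_ hS.prop (fun hj => ?_) ?_
    · intro t ht
      rcases Finset.mem_insert.1 ht with rfl | ht
      exacts [hci.le, hmax t ht]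
    · have := hS.le_of_le hj Finset.sdiff_subset hi
      simp at this
    · have hu := hS.prop.left_mem
      have hw := hS.prop.right_mem
      exact (JoinedWithin.of_adj (by simp [hu, hui]) (by simp [hc_ne]) huc).trans
        (JoinedWithin.of_adj (by simp [hc_ne]) (by simp [hw, hwi]) hwc.symm)

/-- A component whose lower attached nodes are adjacent to a single node `c` of it is a star. -/
theorem isStarWithCenter_of_attached (hG : PreservesWeightedConvexity W G)
    (hC : IsLayerComponent W G l C) {a c : N} (ha : W.p a < l) (hc : c ∈ C)
    (hac : ∀ x ∈ C, G.Adj a x ↔ x = c) : IsStarWithCenter G C c := by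
  have hleaf : ∀ x ∈ C, x ≠ c → G.Adj c x := by
    intro x hx hxc
    rcases hC.adj_or_exists_adj hG ha hc ((hac c hc).2 rfl) hx with h | ⟨z, hz, haz, hzx⟩
    · exact absurd ((hac x hx).1 h) hxc
    · rwa [← (hac z hz).1 haz]
  refine ⟨hc, ?_⟩
  ext ⟨x, hx⟩ ⟨y, hy⟩
  rw [SimpleGraph.starGraph_adj, SimpleGraph.induce_adj]
  simp only [ne_eq, Subtype.mk.injEq]
  constructor
  · intro h
    refine ⟨h.ne, ?_⟩
    by_contra! hn
    have hpc := hC.prio_eq hc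
    have hpx := hC.prio_eq hx
    have hpy := hC.prio_eq hy
    -- Two adjacent leaves would form a triangle with `c`, which the pendant obstruction also
    -- excludes.
    exact hG.false_of_pendant (by omega) (by omega) (by omega) hn.2 ((hac c hc).2 rfl)
      (hleaf x hx hn.1) h (fun h => hn.1 ((hac x hx).1 h)) fun h => hn.2 ((hac y hy).1 h)
  · rintro ⟨hxy, rfl | rfl⟩
    exacts [hleaf y hy (Ne.symm hxy), (hleaf x hx hxy).symm]

/-- Of two lower components that are not linked but attached to the same component, the higher one
is a singleton. -/
theorem not_adj_of_not_linked (hG : PreservesWeightedConvexity W G)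
    (hA₁ : IsLayerComponent W G k A₁) (hA₂ : IsLayerComponent W G l A₂) (hne : A₁ ≠ A₂)
    (hkl : k ≤ l) (hn : ¬ Linked G A₁ A₂) {a₁ a₂ c b : N} (hl : l < W.p c)
    (h₁ : a₁ ∈ A₁) (h₂ : a₂ ∈ A₂) (hc₁ : G.Adj a₁ c) (hc₂ : G.Adj a₂ c) (hb : W.p b ≤ l) :
    ¬ G.Adj a₂ b := by
  intro hadj
  have hp₁ := hA₁.prio_eq h₁
  have hp₂ := hA₂.prio_eq h₂
  have hna : ¬ G.Adj a₁ a₂ := fun h => hn ⟨a₂, h₂, a₁, h₁, h⟩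
  have hnea : a₁ ≠ a₂ := hA₁.ne_of_mem hA₂ hne h₁ h₂
  have hab : a₁ ≠ b := by
    rintro rfl
    exact hna hadj.symm
  have hcb : c ≠ b := by rintro rfl; omega
  by_cases h : G.Adj a₁ b
  · refine hG.not_joined_of_lower (X := {a₁, b, a₂}) hnea hna hc₁ hc₂ (by omega) (by omega) ?_
      ((JoinedWithin.of_adj (by simp) (by simp) h).trans
        (JoinedWithin.of_adj (by simp) (by simp) hadj.symm))
    simp [hc₁.ne.symm, hcb, hc₂.ne.symm]
  · exact hG.false_of_branch (by omega) (by omega) (by omega) hnea hab hc₁ hc₂ hadj hna h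

/-- Attached lower nodes have equal neighbourhoods in `C`, so any attachment of one component serves
the other. -/
theorem exists_common_attachment (hG : PreservesWeightedConvexity W G)
    (hA₁ : IsLayerComponent W G k A₁) (hA₂ : IsLayerComponent W G l A₂)
    (hC : IsLayerComponent W G m C) (hk : k < m) (hl : l < m)
    (h₁ : Linked G A₁ C) (h₂ : Linked G A₂ C) :
    ∃ i ∈ C, LinkedToNode G A₁ i ∧ LinkedToNode G A₂ i := by
  obtain ⟨c₁, hc₁, a₁, ha₁, hadj₁⟩ := h₁
  obtain ⟨c₂, hc₂, a₂, ha₂, hadj₂⟩ := h₂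
  exact ⟨c₂, hc₂, ⟨a₁, ha₁, hC.adj_of_attached hG (by rwa [hA₁.prio_eq ha₁])
    (by rwa [hA₂.prio_eq ha₂]) hc₁ hc₂ hadj₁ hadj₂⟩, ⟨a₂, ha₂, hadj₂⟩⟩

/-- A lower component attached to `C` is linked to every node of `C` to which some lower node is
attached. -/
theorem linkedToNode_of_linked (hG : PreservesWeightedConvexity W G)
    (hA : IsLayerComponent W G k A) (hC : IsLayerComponent W G m C) (hk : k < m)
    (h : Linked G A C) {a i : N} (ha : W.p a < m) (hi : i ∈ C) (hai : G.Adj a i) :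
    LinkedToNode G A i := by
  obtain ⟨c, hc, b, hb, hadj⟩ := h
  exact ⟨b, hb, hC.adj_of_attached hG (by rwa [hA.prio_eq hb]) ha hc hi hadj hai⟩

/-- The structure around two components attached to a higher one, but not linked. -/
theorem structure_of_not_linked (hG : PreservesWeightedConvexity W G)
    (hA₁ : IsLayerComponent W G k A₁) (hA₂ : IsLayerComponent W G l A₂)
    (hC : IsLayerComponent W G m C) (hkl : k ≤ l) (hl : l < m) (hne : A₁ ≠ A₂)
    (h₁ : Linked G A₁ C) (h₂ : Linked G A₂ C) (hn : ¬ Linked G A₁ A₂) :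
    (∃ j₂, A₂ = {j₂}) ∧
      (∃ c ∈ C, IsStarWithCenter G C c ∧ LinkedOnlyAt G A₂ C c ∧ LinkedOnlyAt G A₁ C c ∧
        ∀ u ∈ A₁, ∀ w ∈ A₂, ∀ P : G.Walk u w, P.IsPath → c ∈ P.support) ∧
      (∀ r < l, ∀ D : Finset N, IsLayerComponent W G r D → ¬ Linked G A₂ D) := by
  obtain ⟨c, hc, ⟨a₁, ha₁, hadj₁⟩, ⟨a₂, ha₂, hadj₂⟩⟩ :=
    exists_common_attachment hG hA₁ hA₂ hC (by omega) hl h₁ h₂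
  have hpc := hC.prio_eq hc
  have hp₁ : ∀ {x}, x ∈ A₁ → W.p x = k := fun hx => hA₁.prio_eq hx
  have hp₂ : ∀ {x}, x ∈ A₂ → W.p x = l := fun hx => hA₂.prio_eq hx
  have hpa₁ := hp₁ ha₁
  have hpa₂ := hp₂ ha₂
  have hna : ∀ {x y}, x ∈ A₁ → y ∈ A₂ → ¬ G.Adj x y := fun hx hy h => hn ⟨_, hy, _, hx, h⟩
  have hnea : ∀ {x y}, x ∈ A₁ → y ∈ A₂ → x ≠ y := fun hx hy => hA₁.ne_of_mem hA₂ hne hx hy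
  have honly : ∀ x ∈ C, G.Adj a₁ x → x = c := by
    intro x hx h
    by_contra hxc
    -- A second attachment `x` is shared by `a₂`, giving a path through `x` that avoids `c`.
    have h' := hC.adj_of_attached hG (a₁ := a₂) (a₂ := a₁) (by omega) (by omega) hc hx hadj₂ h
    have hpx := hC.prio_eq hx
    refine hG.not_joined_of_lower (X := {a₁, x, a₂}) (hnea ha₁ ha₂) (hna ha₁ ha₂) hadj₁ hadj₂
      (by omega) (by omega) ?_ ((JoinedWithin.of_adj (by simp) (by simp) h).trans
        (JoinedWithin.of_adj (by simp) (by simp) h'.symm))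
    simp [hadj₁.ne.symm, Ne.symm hxc, hadj₂.ne.symm]
  have honly' : ∀ {b x}, W.p b < m → x ∈ C → G.Adj b x → x = c := fun hb hx h =>
    honly _ hx (hC.adj_of_attached hG (by omega) hb hc hx hadj₁ h)
  have hA₂c : A₂ = {a₂} := by
    refine Finset.eq_singleton_iff_unique_mem.2 ⟨ha₂, fun x hx => ?_⟩
    by_contra hxa
    obtain ⟨z, hz, hadj⟩ := (IsComponentIn.joined hA₂ hx ha₂).exists_adj hxa
    exact not_adj_of_not_linked hG hA₁ hA₂ hne hkl hn (by omega) ha₁ ha₂ hadj₁ hadj₂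
      (hp₂ hz).le hadj
  refine ⟨⟨a₂, hA₂c⟩, ⟨c, hc, ?_, ?_, ?_, ?_⟩, ?_⟩
  · exact isStarWithCenter_of_attached hG hC (a := a₁) (by omega) hc fun x hx =>
      ⟨honly x hx, fun h => h ▸ hadj₁⟩
  · exact fun x hx => ⟨fun ⟨b, hb, h⟩ => honly' (by rw [hp₂ hb]; omega) hx h,
      fun h => ⟨a₂, ha₂, h ▸ hadj₂⟩⟩
  · exact fun x hx => ⟨fun ⟨b, hb, h⟩ => honly' (by rw [hp₁ hb]; omega) hx h,
      fun h => ⟨a₁, ha₁, h ▸ hadj₁⟩⟩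
  · intro u hu w hw P _
    by_contra hcP
    have hcA₁ : c ∉ A₁ := fun h => by have := hp₁ h; omega
    have hcA₂ : c ∉ A₂ := fun h => by have := hp₂ h; omega
    refine hG.not_joined_of_lower (X := A₁ ∪ P.support.toFinset ∪ A₂) (hnea ha₁ ha₂)
      (hna ha₁ ha₂) hadj₁ hadj₂ (by omega) (by omega) (by simp [hcA₁, hcP, hcA₂]) ?_
    refine (((IsComponentIn.joined hA₁ ha₁ hu).mono ?_).trans
      ⟨P, fun z hz => by simp [hz]⟩).trans ((IsComponentIn.joined hA₂ hw ha₂).mono ?_)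
    · exact Finset.subset_union_left.trans Finset.subset_union_left
    · exact Finset.subset_union_right
  · rintro r hr D hD ⟨b, hb, a, ha, hadj⟩
    obtain rfl : a = a₂ := by simpa [hA₂c] using ha
    exact not_adj_of_not_linked hG hA₁ hA₂ hne hkl hn (by omega) ha₁ ha₂ hadj₁ hadj₂
      (by rw [hD.prio_eq hb]; omega) hadj

/-- The structure around two components attached to a higher one that are linked. -/
theorem structure_of_linked (hG : PreservesWeightedConvexity W G)
    (hA₁ : IsLayerComponent W G k A₁) (hA₂ : IsLayerComponent W G l A₂)
    (hC : IsLayerComponent W G m C) (hkl : k ≤ l) (hl : l < m) (hne : A₁ ≠ A₂)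
    (h : Linked G A₁ A₂) :
    k < l ∧ ∀ i ∈ C, LinkedToNode G A₁ i → LinkedToNode G A₂ i →
      ∃ j₁ ∈ A₁, ∃ j₂ ∈ A₂, G.Adj i j₁ ∧ G.Adj j₁ j₂ ∧ G.Adj j₂ i ∧
        ∀ r ≤ l, ∀ A₃ : Finset N, IsLayerComponent W G r A₃ →
          A₃ ≠ A₁ → A₃ ≠ A₂ → Linked G A₃ C →
          LinkedToNode G A₃ j₁ ∧ LinkedToNode G A₃ j₂ ∧ r ≠ k ∧ r ≠ l := by
  refine ⟨lt_of_le_of_ne hkl (hA₁.layer_ne_of_linked hA₂ hne h), ?_⟩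
  rintro i hi ⟨a₁, ha₁, hadj₁⟩ ⟨a₂, ha₂, hadj₂⟩
  have hpi := hC.prio_eq hi
  have hp₁ := hA₁.prio_eq ha₁
  have hp₂ := hA₂.prio_eq ha₂
  have h₁₂ : G.Adj a₁ a₂ :=
    adj_of_linked hG hA₁ hA₂ hne h (by omega) (by omega) ha₁ ha₂ hadj₁ hadj₂
  refine ⟨a₁, ha₁, a₂, ha₂, hadj₁.symm, h₁₂, hadj₂, ?_⟩
  intro r hr A₃ hA₃ hne₁ hne₂ hlink
  obtain ⟨a₃, ha₃, hadj₃⟩ :=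
    linkedToNode_of_linked hG hA₃ hC (by omega) hlink (a := a₁) (by omega) hi hadj₁
  have hp₃ := hA₃.prio_eq ha₃
  -- If not, `a₂` could have no neighbour of priority at most `l`, but `a₁` is one.
  have hlink₂ : Linked G A₃ A₂ := by
    by_contra hn
    exact not_adj_of_not_linked hG hA₃ hA₂ hne₂ hr hn (by omega) ha₃ ha₂ hadj₃ hadj₂
      (by omega) h₁₂.symm
  have h₃₂ : G.Adj a₃ a₂ :=
    adj_of_linked hG hA₃ hA₂ hne₂ hlink₂ (by omega) (by omega) ha₃ ha₂ hadj₃ hadj₂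
  -- Otherwise `a₃`, `a₂`, `a₁` is a detour around the common neighbour `i`.
  have h₃₁ : G.Adj a₃ a₁ := by
    by_contra hn
    refine hG.not_joined_of_lower (X := {a₃, a₂, a₁}) (hA₃.ne_of_mem hA₁ hne₁ ha₃ ha₁) hn hadj₃
      hadj₁ (by omega) (by omega) ?_ ((JoinedWithin.of_adj (by simp) (by simp) h₃₂).trans
        (JoinedWithin.of_adj (by simp) (by simp) h₁₂.symm))
    simp [hadj₁.ne.symm, hadj₂.ne.symm, hadj₃.ne.symm]
  exact ⟨⟨a₃, ha₃, h₃₁⟩, ⟨a₃, ha₃, h₃₂⟩,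
    hA₃.layer_ne_of_linked hA₁ hne₁ ⟨a₁, ha₁, a₃, ha₃, h₃₁⟩,
    hA₃.layer_ne_of_linked hA₂ hne₂ hlink₂⟩

end Layers

theorem mainTheorem4 {N : Type*} [Fintype N] [DecidableEq N]
    (W : WeightSystem N) (G : SimpleGraph N)
    (hG : PreservesWeightedConvexity W G)
    (k k' k'' : ℕ) (hkk' : k ≤ k') (hk'k'' : k' < k'')
    (C₁ C₂ C : Finset N)
    (hC₁ : IsLayerComponent W G k C₁)
    (hC₂ : IsLayerComponent W G k' C₂)
    (hC : IsLayerComponent W G k'' C)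
    (hne : C₁ ≠ C₂)
    (h₁ : Linked G C₁ C) (h₂ : Linked G C₂ C) :
    -- a common node of attachment
    (∃ i ∈ C, LinkedToNode G C₁ i ∧ LinkedToNode G C₂ i) ∧
    -- the case of two components that are not linked
    (¬ Linked G C₁ C₂ →
      (∃ j₂, C₂ = {j₂}) ∧
      (∃ c ∈ C, IsStarWithCenter G C c ∧
        LinkedOnlyAt G C₂ C c ∧
        LinkedOnlyAt G C₁ C c ∧
        ∀ u ∈ C₁, ∀ w ∈ C₂, ∀ P : G.Walk u w, P.IsPath → c ∈ P.support) ∧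
      (∀ l < k', ∀ D : Finset N, IsLayerComponent W G l D → ¬ Linked G C₂ D)) ∧
    -- the case of two linked components
    (Linked G C₁ C₂ →
      k < k' ∧
      ∀ i ∈ C, LinkedToNode G C₁ i → LinkedToNode G C₂ i →
        ∃ j₁ ∈ C₁, ∃ j₂ ∈ C₂, G.Adj i j₁ ∧ G.Adj j₁ j₂ ∧ G.Adj j₂ i ∧
          ∀ l ≤ k', ∀ C₃ : Finset N, IsLayerComponent W G l C₃ →
            C₃ ≠ C₁ → C₃ ≠ C₂ → Linked G C₃ C →
            LinkedToNode G C₃ j₁ ∧ LinkedToNode G C₃ j₂ ∧ l ≠ k ∧ l ≠ k') := by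
  exact ⟨exists_common_attachment hG hC₁ hC₂ hC (by omega) hk'k'' h₁ h₂,
    structure_of_not_linked hG hC₁ hC₂ hC hkk' hk'k'' hne h₁ h₂,
    structure_of_linked hG hC₁ hC₂ hC hkk' hk'k'' hne⟩
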